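/- Let $d \ge 2$, let $S^1 = \mathbb R/2\pi\mathbb Z$, and let $W^{1,\infty}$ be the Banach space of Lipschitz functions $S^1 \to \mathbb R^d$ with norm $\|c\|_{L^\infty} + \|c_\theta\|_{L^\infty}$. Let $W^{1,\infty}_0$ be the subspace of functions with $\int_{S^1} c\,d\theta = 0$, and let $\mathcal I^{1,\infty}_0 = \{c \in W^{1,\infty}_0 : \operatorname{ess\,inf}_\theta |c_\theta| > 0\}$ be the manifold of closed Lipschitz immersions modulo translations. For $c \in \mathcal I^{1,\infty}_0$ write $ds = |c_\theta|\,d\theta$, $D_s = |c_\theta|^{-1}\partial_\theta$, $\ell_c = \int_{S^1} ds$, and let $$G_c(h,k) = \frac1{\ell_c}\int_{S^1} \langle D_s h, D_s k\rangle\, ds, \qquad \check G_c(h) = G_c(h,\cdot).$$ Fix $n \ge 1$, let $\mathcal P^1 \subset W^{1,\infty}$ be the functions that are affine between consecutive points of the grid $2\pi i/n$, $i = 0,\dots,n$, and let $\mathcal P\mathcal I^1_0 = \mathcal P^1 \cap \mathcal I^{1,\infty}_0$, with the metric induced by $G$. Let $a<b$ and let $c : [a,b] \to \mathcal P\mathcal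 I^1_0$ be a geodesic of $(\mathcal P\mathcal I^1_0, G)$, i.e. a $C^2$ path which is a critical point of the energy $\frac12\int_a^b G_c(c_t,c_t)\,dt$ with respect to variations in $\mathcal P\mathcal I^1_0$ with fixed end points. Then $c$ is a soliton solution of the geodesic equation of $(\mathcal I^{1,\infty}_0, G)$, i.e. 1. $c$ satisfies $$c_{tt} = G_c(c,c_t)\,c_t - \tfrac12 G_c(c_t,c_t)\,c + D_s^{-1}\pi_0\Big(\langle D_s c, D_s c_t\rangle D_s c_t - \tfrac12 |D_s c_t|^2 D_s c\Big)$$ on $[a,b]$, where $\pi_0 k = k - \frac1{\ell_c}\int_{S^1} k\,ds$ and, for $k \in L^\infty$ with $\int_{S^1} k\,ds=0$, $D_s^{-1}k$ is the unique $u \in W^{1,\infty}_0$ with $D_s u = k$; and 2. at every time its momentum is a sum of $n$ delta distributions with weights in $\mathbb R^d$: for each $t \in [a,b]$ there are $\alpha^1,\dots,\alpha^n \in \mathbb R^d$ and $\theta^1,\dots,\theta^n \in S^1$ with $$\check G_c(c_t)(k) = \sum_{i=1}^n \langle \alpha^i, k(\theta^i)\rangle \quad \text{for all } k \in W^{1,\infty}.$$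 -/

import Mathlib

open Set MeasureTheory
open scoped ENNReal NNReal ContDiff

noncomputable section

namespace ElasticCurves

/-- The circle `S¹ = ℝ / 2πℤ`. -/
abbrev S1 : Type := AddCircle (2 * Real.pi)

instance factTwoPiPos : Fact (0 < 2 * Real.pi) := ⟨Real.two_pi_pos⟩

/-- The target space `ℝᵈ` with its Euclidean structure. -/
abbrev E (d : ℕ) : Type := EuclideanSpace ℝ (Fin d)

/-- Lebesgue measure on a fundamental domain of the circle. -/
abbrev dθ : Measure ℝ := volume.restrict (Ioc 0 (2 * Real.pi))

/-- Lipschitz functions `S¹ → ℝᵈ` as a linear subspace of all functions. -/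
def lipSubmodule (d : ℕ) : Submodule ℝ (S1 → E d) where
  carrier := {c | ∃ K : ℝ≥0, LipschitzWith K c}
  add_mem' := by
    rintro f g ⟨K, hK⟩ ⟨L, hL⟩
    exact ⟨K + L, hK.add hL⟩
  zero_mem' := ⟨0, LipschitzWith.const 0⟩
  smul_mem' := by
    rintro r f ⟨K, hK⟩
    exact ⟨‖r‖₊ * K, (lipschitzWith_smul r).comp hK⟩

/-- The space `W^{1,∞}` of Lipschitz functions `S¹ → ℝᵈ`.  Its norm is given below
(see `norm_def`); it is not the topology of pointwise convergence. -/
def W (d : ℕ) : Type := lipSubmodule d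

variable {d : ℕ}

instance : AddCommGroup (W d) := inferInstanceAs (AddCommGroup (lipSubmodule d))
instance : Module ℝ (W d) := inferInstanceAs (Module ℝ (lipSubmodule d))
instance : CoeFun (W d) (fun _ => S1 → E d) := ⟨fun c => c.1⟩

theorem W.ext {c h : W d} (H : ∀ x, c x = h x) : c = h := Subtype.ext (funext H)
@[simp] theorem W.add_apply (c h : W d) (x : S1) : (c + h) x = c x + h x := rfl
@[simp] theorem W.smul_apply (r : ℝ) (c : W d) (x : S1) : (r • c) x = r • c x := rfl

theorem W.exists_lipschitz (c : W d) :
    ∃ K : ℝ≥0, LipschitzWith K (fun s : ℝ => c (s : S1)) := by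
  obtain ⟨K, hK⟩ := c.2
  refine ⟨K, LipschitzWith.of_dist_le_mul fun x y => (hK.dist_le_mul _ _).trans ?_⟩
  gcongr
  rw [dist_eq_norm, dist_eq_norm, ← AddCircle.coe_sub]
  exact QuotientAddGroup.norm_mk_le_norm

/-- The derivative `c_θ`, as a `2π`-periodic function on `ℝ`; it exists almost everywhere. -/
def W.der (c : W d) : ℝ → E d := deriv (fun s : ℝ => c (s : S1))

theorem W.ae_differentiableAt (c : W d) :
    ∀ᵐ s ∂dθ, DifferentiableAt ℝ (fun s : ℝ => c (s : S1)) s := by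
  obtain ⟨K, hK⟩ := c.exists_lipschitz
  exact ae_restrict_of_ae hK.ae_differentiableAt

theorem W.memLp_der (c : W d) : MemLp c.der ∞ dθ := by
  obtain ⟨K, hK⟩ := c.exists_lipschitz
  exact memLp_top_of_bound (stronglyMeasurable_deriv _).aestronglyMeasurable K
    (Filter.Eventually.of_forall fun s => norm_deriv_le_of_lipschitz hK)

theorem W.continuous (c : W d) : Continuous (c : S1 → E d) := by
  obtain ⟨K, hK⟩ := c.2
  exact hK.continuous

/-- The linear map `c ↦ (c, c_θ)` into the `ℓ¹`-direct sum of `C(S¹, ℝᵈ)` and `L^∞`. -/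
def jet (d : ℕ) : W d →ₗ[ℝ] WithLp 1 (C(S1, E d) × Lp (E d) ∞ dθ) where
  toFun c := WithLp.toLp 1 (⟨c, c.continuous⟩, c.memLp_der.toLp c.der)
  map_add' c h := by
    have key : (c + h).memLp_der.toLp (c + h).der
        = c.memLp_der.toLp c.der + h.memLp_der.toLp h.der := by
      rw [← MemLp.toLp_add]
      refine MemLp.toLp_congr _ _ ?_
      filter_upwards [c.ae_differentiableAt, h.ae_differentiableAt] with s hc hh
      exact deriv_add hc hh
    rw [key]
    rfl
  map_smul' r c := by
    have key : (r • c).memLp_der.toLp (r • c).der = r • c.memLp_der.toLp c.der := by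
      rw [← MemLp.toLp_const_smul]
      refine MemLp.toLp_congr _ _ ?_
      filter_upwards [c.ae_differentiableAt] with s hc
      exact deriv_const_smul r hc
    rw [key]
    rfl

theorem jet_injective (d : ℕ) : Function.Injective (jet d) := by
  intro c h H
  have H1 := congrArg (fun p : WithLp 1 (C(S1, E d) × Lp (E d) ∞ dθ) => p.fst) H
  exact W.ext fun x => congrArg (fun f : C(S1, E d) => f x) H1

instance : NormedAddCommGroup (W d) :=
  NormedAddCommGroup.induced (W d) _ (jet d) (jet_injective d)
instance : NormedSpace ℝ (W d) := NormedSpace.induced ℝ (W d) _ (jet d)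

/-- The norm of `W^{1,∞}` is `‖c‖_{L^∞} + ‖c_θ‖_{L^∞}`. -/
theorem norm_def (c : W d) :
    ‖c‖ = ‖(⟨c, c.continuous⟩ : C(S1, E d))‖ + (eLpNorm c.der ∞ dθ).toReal := by
  have h : ‖c‖ = ‖jet d c‖ := rfl
  rw [h, WithLp.prod_norm_eq_of_L1]
  congr 1
  exact Lp.norm_toLp c.der c.memLp_der

/-- Lipschitz immersions: the essential infimum of `|c_θ|` is positive. -/
def IsImmersion (c : W d) : Prop := ∃ m : ℝ, 0 < m ∧ ∀ᵐ s ∂dθ, m ≤ ‖c.der s‖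

/-- `W^{1,∞}_0`: functions with vanishing mean. -/
def W0 (d : ℕ) : Set (W d) := {h | ∫ s in (0 : ℝ)..(2 * Real.pi), h (s : S1) = 0}

/-- `I^{1,∞}_0`: Lipschitz immersions with vanishing mean (immersions modulo translations). -/
def I0 (d : ℕ) : Set (W d) := {c | IsImmersion c ∧ c ∈ W0 d}

/-- The length `ℓ_c`. -/
def len (c : W d) : ℝ := ∫ s in (0 : ℝ)..(2 * Real.pi), ‖c.der s‖

/-- The arc length derivative `D_s h = h_θ / |c_θ|` along `c`. -/
def Ds (c h : W d) (s : ℝ) : E d := ‖c.der s‖⁻¹ • h.der s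

/-- The metric `G_c(h, k) = (1 / ℓ_c) ∫ ⟨D_s h, D_s k⟩ ds`, where `ds = |c_θ| dθ`. -/
def G (c h k : W d) : ℝ :=
  (len c)⁻¹ * ∫ s in (0 : ℝ)..(2 * Real.pi), inner ℝ (Ds c h s) (Ds c k s) * ‖c.der s‖

/-- The momentum `Ǧ_c(h)`, as a functional on `W^{1,∞}`. -/
def momentum (c h : W d) : W d → ℝ := fun k => G c h k

/-- The `ℝᵈ`-weighted delta distribution `⟨α, δ_θ⟩`, as a functional on `W^{1,∞}`. -/
def delta (α : E d) (θ : S1) : W d → ℝ := fun k => inner ℝ α (k θ)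

/-- The projection `π₀ k = k - (1 / ℓ_c) ∫ k ds`, orthogonal in `L²(ds)`. -/
def proj0 (c : W d) (k : ℝ → E d) (s : ℝ) : E d :=
  k s - (len c)⁻¹ • ∫ η in (0 : ℝ)..(2 * Real.pi), ‖c.der η‖ • k η

/-- `D_s⁻¹ k`, the primitive of `k` with respect to arc length whose mean (in `θ`) vanishes,
for `k` with `∫ k ds = 0`. -/
def DsInv (c : W d) (k : ℝ → E d) (θ : ℝ) : E d :=
  (∫ η in (0 : ℝ)..θ, ‖c.der η‖ • k η) -
    (2 * Real.pi)⁻¹ • ∫ ζ in (0 : ℝ)..(2 * Real.pi), ∫ η in (0 : ℝ)..ζ, ‖c.der η‖ • k η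

/-- The velocity `c_t` of a path on the time interval `[a, b]` (one-sided at the ends),
the derivative being taken in the normed space `W^{1,∞}`. -/
def vel (a b : ℝ) (c : ℝ → W d) : ℝ → W d := fun t => derivWithin c (Icc a b) t

/-- The acceleration `c_tt` of a path on the time interval `[a, b]`. -/
def acc (a b : ℝ) (c : ℝ → W d) : ℝ → W d := vel a b (vel a b c)

/-- The Riemannian energy of a path on the time interval `[a, b]`. -/
def energy (a b : ℝ) (c : ℝ → W d) : ℝ :=
  (1 / 2) * ∫ t in a..b, G (c t) (vel a b c t) (vel a b c t)

/-- `P¹`: functions which are affine between consecutive points of the grid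
`0, 2π/n, …, 2π(n-1)/n, 2π`. -/
def PL (d n : ℕ) : Set (W d) :=
  {h | ∀ i < n, ∀ r ∈ Icc (0 : ℝ) 1,
    h ((2 * Real.pi * (i + r) / n : ℝ) : S1) =
      (1 - r) • h ((2 * Real.pi * i / n : ℝ) : S1)
        + r • h ((2 * Real.pi * (i + 1) / n : ℝ) : S1)}

/-- A geodesic on `[a, b]` of the manifold `PI¹₀ = P¹ ∩ I^{1,∞}_0` of piecewise linear immersions
with the metric induced by `G`: a path in `PI¹₀` which is a critical point of the energy with
respect to variations in `PI¹₀` with fixed end points. -/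
structure IsPLGeodesic (n : ℕ) (a b : ℝ) (c : ℝ → W d) : Prop where
  contDiffOn : ContDiffOn ℝ 2 c (Icc a b)
  mem : ∀ t ∈ Icc a b, c t ∈ PL d n ∩ I0 d
  critical : ∀ h : ℝ → W d, ContDiff ℝ ∞ h → (∀ t, h t ∈ PL d n ∩ W0 d) → h a = 0 → h b = 0 →
    HasDerivAt (fun ε : ℝ => energy a b (fun t => c t + ε • h t)) 0 0

/-- The geodesic equation of `(I^{1,∞}_0, G)`:
`c_tt = G_c(c, c_t) c_t - ½ G_c(c_t, c_t) c
  + D_s⁻¹ π₀ (⟨D_s c, D_s c_t⟩ D_s c_t - ½ |D_s c_t|² D_s c)`. -/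
def SolvesGeodesicEquation (a b : ℝ) (c : ℝ → W d) : Prop :=
  ContDiffOn ℝ 2 c (Icc a b) ∧ (∀ t ∈ Icc a b, c t ∈ I0 d) ∧
  ∀ t ∈ Icc a b, ∀ θ : ℝ,
    acc a b c t (θ : S1) =
      G (c t) (c t) (vel a b c t) • vel a b c t (θ : S1)
      - (1 / 2 * G (c t) (vel a b c t) (vel a b c t)) • c t (θ : S1)
      + DsInv (c t) (proj0 (c t) (fun s =>
          (inner ℝ (Ds (c t) (c t) s) (Ds (c t) (vel a b c t) s) : ℝ) • Ds (c t) (vel a b c t) s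
          - (1 / 2 * ‖Ds (c t) (vel a b c t) s‖ ^ 2) • Ds (c t) (c t) s)) θ

/-- A soliton: a path in `I^{1,∞}_0` whose momentum `Ǧ_c(c_t)` is at every time a sum of `n`
weighted delta distributions. -/
def IsSoliton (n : ℕ) (a b : ℝ) (c : ℝ → W d) : Prop :=
  (∀ t ∈ Icc a b, c t ∈ I0 d) ∧
  ∀ t ∈ Icc a b, ∃ (α : Fin n → E d) (θ : Fin n → S1),
    momentum (c t) (vel a b c t) = ∑ i, delta (α i) (θ i)

end ElasticCurves

end

/-!
On `P¹ ∩ W^{1,∞}_0` a curve is determined by its slopes `x_i` on the `n` cells, subject only to the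
closing condition `∑ x_i = 0`, and `G_c(c_t, c_t)` becomes the Lagrangian
`(∑ |x_i|)⁻¹ ∑ |x_i|⁻¹ |y_i|²` with `y_i` the velocity of `x_i` (`G_self_eq_lagrangian`).
Criticality of the energy therefore yields Euler–Lagrange equations with a multiplier: the residual is the same
vector on every edge. Here differentiation under the integral sign is
`hasDerivAt_integral_add_smul`, the passage to pointwise equations is the du Bois-Reymond lemma
`derivWithin_eq_of_forall_integral_eq_zero`, and hat functions supply enough variations to compare
neighbouring edges (`eq_of_forall_sum_inner_tent`).

Summing the equations over the edges determines the multiplier, because the accelerations also sum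
to zero; it is exactly the mean which `π₀` subtracts (`acceleration_eq_of_multiplier`). So the
geodesic equation of the full space holds after applying `∂_θ` on each cell. The space `P¹` is
closed and linear, hence contains `c_t` and `c_tt`, and both sides of the equation have mean zero,
so the equation itself follows by integration (`DsInv_eq`).

The momentum is a sum of delta distributions since `D_s c_t` is constant on each cell: the
fundamental theorem of calculus for Lipschitz functions (`W.integral_der`) turns `G_c(c_t, k)` into
a combination of the values of `k` at the nodes (`momentum_eq_sum_delta`).
-/

noncomputable section

namespace ElasticCurves

variable {d : ℕ}

/-! ### Lipschitz functions on the circle -/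

theorem W.intervalIntegrable_der (h : W d) (x y : ℝ) : IntervalIntegrable h.der volume x y := by
  obtain ⟨K, hK⟩ := h.exists_lipschitz
  refine (intervalIntegrable_const (c := (K : ℝ))).mono_fun
    (stronglyMeasurable_deriv _).aestronglyMeasurable ?_
  refine Filter.Eventually.of_forall fun s => ?_
  exact (norm_deriv_le_of_lipschitz hK).trans (Real.le_norm_self _)

/-- The fundamental theorem of calculus for Lipschitz functions on the circle. -/
theorem W.integral_der (h : W d) (x y : ℝ) :
    ∫ s in x..y, h.der s = h (y : S1) - h (x : S1) := by
  obtain ⟨K, hK⟩ := h.exists_lipschitz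
  refine ext_inner_left ℝ fun u => ?_
  have h1 : (innerSL ℝ u) (∫ s in x..y, h.der s) = ∫ s in x..y, innerSL ℝ u (h.der s) :=
    ((innerSL ℝ u).intervalIntegral_comp_comm (h.intervalIntegrable_der x y)).symm
  have hL : LipschitzWith (‖innerSL ℝ u‖₊ * K) (fun s : ℝ => innerSL ℝ u (h (s : S1))) :=
    (innerSL ℝ u).lipschitz.comp hK
  have h2 := hL.lipschitzOnWith (s := uIcc x y)
    |>.absolutelyContinuousOnInterval.integral_deriv_eq_sub
  have h3 : ∫ s in x..y, innerSL ℝ u (h.der s)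
      = ∫ s in x..y, deriv (fun s : ℝ => innerSL ℝ u (h (s : S1))) s := by
    refine intervalIntegral.integral_congr_ae ?_
    filter_upwards [hK.ae_differentiableAt] with s hs _
    exact ((innerSL ℝ u).hasFDerivAt.comp_hasDerivAt s hs.hasDerivAt).deriv.symm
  rw [h3, h2] at h1
  simpa [inner_sub_right] using h1

theorem W.norm_apply_le (h : W d) (x : S1) : ‖h x‖ ≤ ‖h‖ := by
  rw [norm_def]
  have := ContinuousMap.norm_coe_le_norm (⟨h, h.continuous⟩ : C(S1, E d)) x
  have h2 : 0 ≤ (eLpNorm h.der ∞ dθ).toReal := ENNReal.toReal_nonneg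
  simp only [ContinuousMap.coe_mk] at this
  linarith

/-- Evaluation at a point of the circle, a continuous linear map on `W^{1,∞}`. -/
def evalL (x : S1) : W d →L[ℝ] E d :=
  LinearMap.mkContinuous ⟨⟨fun h => h x, fun _ _ => rfl⟩, fun _ _ => rfl⟩ 1 fun h => by
    rw [one_mul]; exact h.norm_apply_le x

@[simp] theorem evalL_apply (x : S1) (h : W d) : evalL x h = h x := rfl

theorem W.continuous_lift (h : W d) : Continuous (fun s : ℝ => h (s : S1)) :=
  h.continuous.comp (AddCircle.continuous_mk' _)

/-- The integral over the circle, a continuous linear map on `W^{1,∞}` with kernel `W^{1,∞}_0`. -/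
def integralL : W d →L[ℝ] E d :=
  LinearMap.mkContinuous
    { toFun := fun h => ∫ s in (0 : ℝ)..(2 * Real.pi), h (s : S1)
      map_add' := fun h k => intervalIntegral.integral_add
        (h.continuous_lift.intervalIntegrable _ _) (k.continuous_lift.intervalIntegrable _ _)
      map_smul' := fun r h => intervalIntegral.integral_smul r _ } (2 * Real.pi) fun h => by
    have := intervalIntegral.norm_integral_le_of_norm_le_const (a := 0) (b := 2 * Real.pi)
      (f := fun s : ℝ => h (s : S1)) (C := ‖h‖) fun s _ => h.norm_apply_le _
    exact this.trans (by rw [sub_zero, abs_of_pos Real.two_pi_pos, mul_comm])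

theorem mem_W0_iff {h : W d} : h ∈ W0 d ↔ integralL h = 0 := Iff.rfl

/-! ### Piecewise linear functions -/

/-- The width `2π/n` of a cell. -/
def width (n : ℕ) : ℝ := 2 * Real.pi / n

theorem width_pos {n : ℕ} (hn : 0 < n) : 0 < width n := by
  unfold width; have := Real.pi_pos; positivity

theorem nat_mul_width {n : ℕ} (hn : 0 < n) : n * width n = 2 * Real.pi := by
  unfold width; field_simp

/-- The grid point `2πi/n` on the circle. -/
def node (n i : ℕ) : S1 := ((i * width n : ℝ) : S1)

theorem node_self {n : ℕ} (hn : 0 < n) : node n n = node n 0 := by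
  simp [node, nat_mul_width hn, AddCircle.coe_period]

/-- The slope of the affine function on the `i`-th cell with the same end point values. -/
def edge (n i : ℕ) : W d →L[ℝ] E d := (width n)⁻¹ • (evalL (node n (i + 1)) - evalL (node n i))

theorem edge_apply (n i : ℕ) (h : W d) :
    edge n i h = (width n)⁻¹ • (h (node n (i + 1)) - h (node n i)) := rfl

theorem sum_edge {n : ℕ} (hn : 0 < n) (h : W d) : ∑ i ∈ Finset.range n, edge n i h = 0 := by
  simp only [edge_apply, ← Finset.smul_sum]
  rw [Finset.sum_range_sub (fun i => h (node n i)), node_self hn, sub_self, smul_zero]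

/-- The functional whose vanishing for all `i < n` and `r ∈ [0, 1]` defines `P¹`. -/
def affineDefect (n i : ℕ) (r : ℝ) : W d →L[ℝ] E d :=
  evalL ((2 * Real.pi * (i + r) / n : ℝ) : S1)
    - ((1 - r) • evalL ((2 * Real.pi * i / n : ℝ) : S1)
      + r • evalL ((2 * Real.pi * (i + 1) / n : ℝ) : S1))

theorem mem_PL_iff {n : ℕ} {h : W d} :
    h ∈ PL d n ↔ ∀ i < n, ∀ r ∈ Icc (0 : ℝ) 1, affineDefect n i r h = 0 := by
  simp [PL, affineDefect, sub_eq_zero]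

theorem PL_add_smul {n : ℕ} {g h : W d} (hg : g ∈ PL d n) (hh : h ∈ PL d n) (r : ℝ) :
    g + r • h ∈ PL d n := by
  rw [mem_PL_iff] at *
  intro i hi s hs
  rw [map_add, map_smul, hg i hi s hs, hh i hi s hs]; simp

theorem zero_mem_PL_inter_W0 (d n : ℕ) : (0 : W d) ∈ PL d n ∩ W0 d :=
  ⟨by simp [mem_PL_iff], by simp [mem_W0_iff]⟩

theorem W0_add_smul {g h : W d} (hg : g ∈ W0 d) (hh : h ∈ W0 d) (r : ℝ) :
    g + r • h ∈ W0 d := by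
  rw [mem_W0_iff] at *
  rw [map_add, map_smul, hg, hh]; simp

theorem PL.apply_cell {n : ℕ} (hn : 0 < n) {h : W d} (hh : h ∈ PL d n) {i : ℕ} (hi : i < n)
    {s : ℝ} (hs : s ∈ Icc (i * width n) ((i + 1 : ℕ) * width n)) :
    h (s : S1) = h (node n i) + (s - i * width n) • edge n i h := by
  have hw := width_pos hn
  set r : ℝ := (s - i * width n) / width n with hr
  have hr01 : r ∈ Icc (0 : ℝ) 1 := by
    have := hs.1; have h2 := hs.2
    push_cast at h2
    constructor
    · exact div_nonneg (by linarith) hw.le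
    · rw [div_le_one hw]; linarith
  have key := hh i hi r hr01
  have e1 : 2 * Real.pi * (i + r) / n = s := by
    have h1 : 2 * Real.pi * (i + r) / n = width n * (i + r) := by unfold width; ring
    rw [h1, hr]; field_simp; ring
  have e2 : ((2 * Real.pi * i / n : ℝ) : S1) = node n i := by
    unfold node width; congr 1; ring
  have e3 : ((2 * Real.pi * (i + 1) / n : ℝ) : S1) = node n (i + 1) := by
    unfold node width; congr 1; push_cast; ring
  rw [e1, e2, e3] at key
  rw [key, edge_apply, smul_smul, ← div_eq_mul_inv, ← hr]
  module

theorem PL.der_cell {n : ℕ} (hn : 0 < n) {h : W d} (hh : h ∈ PL d n) {i : ℕ} (hi : i < n)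
    {s : ℝ} (hs : s ∈ Ioo (i * width n) ((i + 1 : ℕ) * width n)) :
    h.der s = edge n i h := by
  have : (fun s : ℝ => h (s : S1)) =ᶠ[nhds s]
      fun s => h (node n i) + (s - i * width n) • edge n i h := by
    filter_upwards [Ioo_mem_nhds hs.1 hs.2] with x hx
    exact PL.apply_cell hn hh hi (Ioo_subset_Icc_self hx)
  rw [W.der, this.deriv_eq]
  have h1 : HasDerivAt (fun s : ℝ => h (node n i) + (s - i * width n) • edge n i h)
      ((1 : ℝ) • edge n i h) s :=
    (((hasDerivAt_id s).sub_const _).smul_const _).const_add _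
  rw [h1.deriv, one_smul]

theorem W.der_periodic (h : W d) : Function.Periodic h.der (2 * Real.pi) := by
  intro s
  unfold W.der
  rw [← deriv_comp_add_const]
  congr 1
  funext x
  rw [AddCircle.coe_add_period]

/-- The integral over the circle of a function which is constant on the cells. -/
theorem integral_eq_sum_cells {F : Type*} [NormedAddCommGroup F] [NormedSpace ℝ F]
    [CompleteSpace F] {n : ℕ}
    (hn : 0 < n) {f : ℝ → F} {v : ℕ → F}
    (hf : ∀ i < n, ∀ s ∈ Ioo (i * width n) ((i + 1 : ℕ) * width n), f s = v i) :
    ∫ s in (0 : ℝ)..(2 * Real.pi), f s = width n • ∑ i ∈ Finset.range n, v i := by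
  have hle (i : ℕ) : i * width n ≤ (i + 1 : ℕ) * width n := by
    have := width_pos hn; push_cast; nlinarith
  have hae (i : ℕ) (hi : i < n) :
      ∀ᵐ s, s ∈ uIoc (i * width n) ((i + 1 : ℕ) * width n) → f s = v i := by
    filter_upwards [Measure.ae_ne volume ((i + 1 : ℕ) * width n)] with s hs hs'
    rw [uIoc_of_le (hle i)] at hs'
    exact hf i hi s ⟨hs'.1, lt_of_le_of_ne hs'.2 hs⟩
  have h1 := intervalIntegral.sum_integral_adjacent_intervals (f := f) (μ := volume)
    (a := fun i : ℕ => i * width n) (n := n) fun i hi => by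
      refine (intervalIntegrable_const (c := v i)).congr_ae ?_
      rw [Filter.EventuallyEq, ae_restrict_iff' measurableSet_uIoc]
      filter_upwards [hae i hi] with s hs hs' using (hs hs').symm
  simp only [Nat.cast_zero, zero_mul, nat_mul_width hn] at h1
  rw [← h1, Finset.smul_sum]
  refine Finset.sum_congr rfl fun i hi => ?_
  rw [intervalIntegral.integral_congr_ae (hae i (Finset.mem_range.1 hi)),
    intervalIntegral.integral_const]
  congr 1
  push_cast; ring

/-- Almost every point of `ℝ` lies, modulo `2π`, in one of the open cells. -/
theorem ae_exists_cell {n : ℕ} (hn : 0 < n) :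
    ∀ᵐ s : ℝ, ∃ i < n, ∀ h ∈ PL d n, h.der s = edge n i h := by
  have hw := width_pos hn
  have hc : (range fun z : ℤ => (z : ℝ) * width n).Countable := countable_range _
  filter_upwards [hc.ae_notMem volume] with s hs
  set m : ℤ := ⌊s / width n⌋ with hm
  have h1 : (m : ℝ) * width n ≤ s := by
    rw [← le_div_iff₀ hw]; exact Int.floor_le _
  have h1' : (m : ℝ) * width n < s := lt_of_le_of_ne h1 fun h => hs ⟨m, h⟩
  have h2 : s < (m + 1 : ℝ) * width n := by
    rw [← div_lt_iff₀ hw]; exact Int.lt_floor_add_one _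
  have hn' : (n : ℤ) ≠ 0 := by exact_mod_cast hn.ne'
  obtain ⟨i, hi⟩ := Int.eq_ofNat_of_zero_le (Int.emod_nonneg m hn')
  have hin : i < n := by
    have := Int.emod_lt_of_pos m (by exact_mod_cast hn : (0 : ℤ) < n)
    omega
  have hmi : (m : ℝ) = i + n * (m / n : ℤ) := by
    have := Int.emod_add_mul_ediv m n
    rw [hi] at this
    exact_mod_cast this.symm
  refine ⟨i, hin, fun h hh => ?_⟩
  have hp := h.der_periodic.sub_zsmul_eq (x := s) (m / n)
  rw [← hp]
  have hz : (m / n : ℤ) • (2 * Real.pi) = (m / n : ℤ) * (n * width n) := by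
    rw [nat_mul_width hn, zsmul_eq_mul]
  refine PL.der_cell hn hh hin ?_
  rw [hz]
  push_cast
  rw [hmi] at h1' h2
  constructor <;> nlinarith

/-! ### Metric and momentum of piecewise linear curves -/

theorem len_eq {n : ℕ} (hn : 0 < n) {c : W d} (hc : c ∈ PL d n) :
    len c = width n * ∑ i ∈ Finset.range n, ‖edge n i c‖ :=
  integral_eq_sum_cells hn fun i hi s hs => by rw [PL.der_cell hn hc hi hs]

theorem G_eq {n : ℕ} (hn : 0 < n) {c h k : W d} (hc : c ∈ PL d n) (hh : h ∈ PL d n)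
    (hk : k ∈ PL d n) :
    G c h k = (∑ i ∈ Finset.range n, ‖edge n i c‖)⁻¹ *
      ∑ i ∈ Finset.range n, ‖edge n i c‖⁻¹ * inner ℝ (edge n i h) (edge n i k) := by
  have h1 : ∫ s in (0 : ℝ)..(2 * Real.pi), inner ℝ (Ds c h s) (Ds c k s) * ‖c.der s‖
      = width n • ∑ i ∈ Finset.range n,
        ‖edge n i c‖⁻¹ * inner ℝ (edge n i h) (edge n i k) := by
    refine integral_eq_sum_cells hn fun i hi s hs => ?_
    simp only [Ds, PL.der_cell hn hc hi hs, PL.der_cell hn hh hi hs, PL.der_cell hn hk hi hs,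
      inner_smul_left, inner_smul_right, RCLike.conj_to_real]
    rcases eq_or_ne ‖edge n i c‖ 0 with h0 | h0
    · simp [h0]
    · field_simp
  have hw := (width_pos hn).ne'
  rw [G, h1, len_eq hn hc, mul_inv, smul_eq_mul]
  field_simp

theorem PL.edge_ne_zero {n : ℕ} (hn : 0 < n) {c : W d} (hc : c ∈ PL d n) (him : IsImmersion c)
    {i : ℕ} (hi : i < n) : edge n i c ≠ 0 := by
  obtain ⟨m, hm, hae⟩ := him
  intro h0
  have hw := width_pos hn
  have hsub : Ioo (i * width n) ((i + 1 : ℕ) * width n) ⊆ Ioc 0 (2 * Real.pi) := by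
    intro s hs
    have h1 : ((i + 1 : ℕ) : ℝ) * width n ≤ n * width n := by gcongr; exact hi
    rw [nat_mul_width hn] at h1
    have h2 : 0 ≤ (i : ℝ) * width n := by positivity
    exact ⟨h2.trans_lt hs.1, hs.2.le.trans h1⟩
  have h1 := ae_restrict_of_ae_restrict_of_subset hsub hae
  have h2 : volume (Ioo ((i : ℝ) * width n) ((i + 1 : ℕ) * width n)) ≠ 0 := by
    rw [Real.volume_Ioo]
    push_cast
    simpa [add_mul] using hw
  rw [ae_restrict_iff' measurableSet_Ioo] at h1
  refine h2 (measure_mono_null (fun s hs => ?_) h1)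
  simp only [mem_compl_iff, mem_ofPred_eq, Classical.not_imp]
  refine ⟨hs, ?_⟩
  rw [PL.der_cell hn hc hi hs, h0, norm_zero]
  exact not_le.2 hm

/-- The momentum of a piecewise linear velocity along a piecewise linear curve: integration by
parts leaves only the jumps of `D_s h` at the nodes. -/
theorem momentum_eq_sum_delta {n : ℕ} (hn : 0 < n) {c h : W d} (hc : c ∈ PL d n)
    (hh : h ∈ PL d n) :
    ∃ (α : Fin n → E d) (θ : Fin n → S1), momentum c h = ∑ i, delta (α i) (θ i) := by
  obtain ⟨m, rfl⟩ : ∃ m, n = m + 1 := ⟨n - 1, by omega⟩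
  set p : ℕ → E d := fun i => (len c)⁻¹ • (‖edge (m + 1) i c‖⁻¹ • edge (m + 1) i h) with hp
  refine ⟨fun i => p (if (i : ℕ) = 0 then m else (i : ℕ) - 1) - p i, fun i => node (m + 1) i, ?_⟩
  funext k
  have hle (i : ℕ) : i * width (m + 1) ≤ (i + 1 : ℕ) * width (m + 1) := by
    have := width_pos hn; push_cast; nlinarith
  have hcell (i : ℕ) (hi : i < m + 1) : ∀ᵐ s,
      s ∈ uIoc (i * width (m + 1)) ((i + 1 : ℕ) * width (m + 1)) →
      innerSL ℝ (‖edge (m + 1) i c‖⁻¹ • edge (m + 1) i h) (k.der s)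
        = inner ℝ (Ds c h s) (Ds c k s) * ‖c.der s‖ := by
    filter_upwards [Measure.ae_ne volume ((i + 1 : ℕ) * width (m + 1))] with s hs hs'
    rw [uIoc_of_le (hle i)] at hs'
    have hs2 : s ∈ Ioo (i * width (m + 1)) ((i + 1 : ℕ) * width (m + 1)) :=
      ⟨hs'.1, lt_of_le_of_ne hs'.2 hs⟩
    simp only [Ds, PL.der_cell hn hc hi hs2, PL.der_cell hn hh hi hs2,
      innerSL_apply_apply, inner_smul_left, inner_smul_right, RCLike.conj_to_real]
    rcases eq_or_ne ‖edge (m + 1) i c‖ 0 with h0 | h0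
    · simp [h0]
    · field_simp
  have hlin (i : ℕ) : IntervalIntegrable
      (fun s => innerSL ℝ (‖edge (m + 1) i c‖⁻¹ • edge (m + 1) i h) (k.der s)) volume
      (i * width (m + 1)) ((i + 1 : ℕ) * width (m + 1)) :=
    ⟨(innerSL ℝ _).integrable_comp (k.intervalIntegrable_der _ _).1,
      (innerSL ℝ _).integrable_comp (k.intervalIntegrable_der _ _).2⟩
  have h1 := intervalIntegral.sum_integral_adjacent_intervals
    (f := fun s => inner ℝ (Ds c h s) (Ds c k s) * ‖c.der s‖) (μ := volume)
    (a := fun i : ℕ => i * width (m + 1)) (n := m + 1) fun i hi => by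
      refine (hlin i).congr_ae ?_
      rw [Filter.EventuallyEq, ae_restrict_iff' measurableSet_uIoc]
      exact hcell i hi
  simp only [Nat.cast_zero, zero_mul, nat_mul_width hn] at h1
  have h2 (i : ℕ) (hi : i < m + 1) :
      ∫ s in (i * width (m + 1))..((i + 1 : ℕ) * width (m + 1)),
        inner ℝ (Ds c h s) (Ds c k s) * ‖c.der s‖
      = inner ℝ (‖edge (m + 1) i c‖⁻¹ • edge (m + 1) i h)
          (k (node (m + 1) (i + 1)) - k (node (m + 1) i)) := by
    rw [← intervalIntegral.integral_congr_ae (hcell i hi),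
      (innerSL ℝ _).intervalIntegral_comp_comm (k.intervalIntegrable_der _ _), k.integral_der]
    rfl
  have h3 : G c h k = ∑ i ∈ Finset.range (m + 1),
      inner ℝ (p i) (k (node (m + 1) (i + 1)) - k (node (m + 1) i)) := by
    rw [G, ← h1, Finset.mul_sum]
    refine Finset.sum_congr rfl fun i hi => ?_
    rw [h2 i (Finset.mem_range.1 hi), hp, inner_smul_left (𝕜 := ℝ) _ _ (len c)⁻¹]
    rfl
  rw [momentum, h3, Finset.sum_apply]
  simp only [delta]
  rw [Fin.sum_univ_eq_sum_range (fun i => inner ℝ (p (if i = 0 then m else i - 1) - p i)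
    (k (node (m + 1) i))) (m + 1)]
  simp only [inner_sub_left, inner_sub_right, Finset.sum_sub_distrib]
  congr 1
  rw [Finset.sum_range_succ, Finset.sum_range_succ' _ m, node_self hn]
  simp

/-! ### Piecewise linear test functions -/

/-- The constant function, as an element of `W^{1,∞}`. -/
def constW (v : E d) : W d := ⟨fun _ => v, 0, LipschitzWith.const v⟩

theorem constW_mem_PL (n : ℕ) (v : E d) : constW v ∈ PL d n := fun i _ r _ => by
  change v = (1 - r) • v + r • v
  module

/-- The hat function `x ↦ max 0 (w - |x - θ_j|) u`, where `w` is the width of a cell and `θ_j`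
the `j`-th node. -/
def hat (n j : ℕ) (u : E d) : W d :=
  ⟨fun x => max 0 (width n - ‖x - node n j‖) • u, by
    have h1 : LipschitzWith 1 fun x : S1 => max 0 (width n - ‖x - node n j‖) := by
      refine LipschitzWith.const_max ?_ 0
      refine LipschitzWith.of_dist_le_mul fun x y => ?_
      rw [NNReal.coe_one, one_mul, Real.dist_eq, dist_eq_norm,
        show width n - ‖x - node n j‖ - (width n - ‖y - node n j‖)
          = ‖y - node n j‖ - ‖x - node n j‖ by ring]
      refine (abs_norm_sub_norm_le _ _).trans (le_of_eq ?_)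
      rw [← norm_neg]; congr 1; abel
    refine ⟨‖u‖₊, LipschitzWith.of_dist_le_mul fun x y => ?_⟩
    rw [dist_eq_norm, ← sub_smul, norm_smul, mul_comm, ← dist_eq_norm, coe_nnnorm]
    gcongr
    simpa using h1.dist_le_mul x y⟩

/-- For an interior node, the hat on the circle agrees with the hat on `[0, 2π]`. -/
theorem hat_apply {n j : ℕ} (hj : 0 < j) (hjn : j < n) (u : E d) {x : ℝ} (hx0 : 0 ≤ x)
    (hxn : x ≤ n) :
    hat n j u ((x * width n : ℝ) : S1) = (width n * max 0 (1 - |x - j|)) • u := by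
  have hn : 0 < n := hj.trans hjn
  have hw := width_pos hn
  have hnw := nat_mul_width hn
  change max 0 (width n - ‖((x * width n : ℝ) : S1) - node n j‖) • u = _
  congr 1
  have hsub : ((x * width n : ℝ) : S1) - node n j = (((x - j) * width n : ℝ) : S1) := by
    rw [node, ← AddCircle.coe_sub]; congr 1; ring
  rw [hsub, mul_max_of_nonneg _ _ hw.le, mul_zero]
  have hpi := Real.pi_pos
  have h1j : (1 : ℝ) ≤ j := by exact_mod_cast hj
  have hjn' : (j : ℝ) + 1 ≤ n := by exact_mod_cast hjn
  have habs : |(x - j) * width n| = |x - j| * width n := by rw [abs_mul, abs_of_pos hw]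
  have hle : |x - j| ≤ n - 1 := abs_le.2 ⟨by linarith, by linarith⟩
  have hle' : |x - j| * width n ≤ (n - 1) * width n := by gcongr
  by_cases hy : |(x - j) * width n| ≤ |2 * Real.pi| / 2
  · rw [(AddCircle.norm_coe_eq_abs_iff _ (by positivity)).2 hy, habs]
    congr 1; ring
  -- Beyond half a period the distance on the circle is `2π - |x - θ_j| ≥ w`.
  · rw [not_le, abs_of_pos Real.two_pi_pos, habs] at hy
    have hge : width n ≤ ‖(((x - j) * width n : ℝ) : S1)‖ := by
      rcases le_total 0 (x - j) with h0 | h0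
      · rw [abs_of_nonneg h0] at hy hle'
        have h3 : ((((x - j) * width n : ℝ)) : S1)
            = (((x - j) * width n - 2 * Real.pi : ℝ) : S1) := by
          rw [AddCircle.coe_sub, AddCircle.coe_period, sub_zero]
        have h4 : |(x - j) * width n - 2 * Real.pi| = 2 * Real.pi - (x - j) * width n := by
          rw [abs_of_nonpos (by linarith)]; ring
        rw [h3, (AddCircle.norm_coe_eq_abs_iff _ (by positivity)).2
          (by rw [h4, abs_of_pos Real.two_pi_pos]; linarith), h4]
        linarith
      · rw [abs_of_nonpos h0] at hy hle'
        have h3 : ((((x - j) * width n : ℝ)) : S1)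
            = (((x - j) * width n + 2 * Real.pi : ℝ) : S1) := by
          rw [AddCircle.coe_add, AddCircle.coe_period, add_zero]
        have h4 : |(x - j) * width n + 2 * Real.pi| = 2 * Real.pi + (x - j) * width n := by
          rw [abs_of_nonneg (by linarith)]; ring
        rw [h3, (AddCircle.norm_coe_eq_abs_iff _ (by positivity)).2
          (by rw [h4, abs_of_pos Real.two_pi_pos]; linarith), h4]
        linarith
    have hn2 : (2 : ℝ) ≤ n := by linarith
    have hone : 1 ≤ |x - j| := by
      by_contra hlt
      rw [not_le] at hlt
      nlinarith
    rw [max_eq_left (by linarith), max_eq_left (by nlinarith)]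

/-- The hat profile `max 0 (1 - |x|)` is affine between consecutive integers. -/
theorem max_zero_one_sub_abs_add (z : ℤ) {r : ℝ} (hr : r ∈ Icc (0 : ℝ) 1) :
    max 0 (1 - |z + r|) = (1 - r) * max 0 (1 - |(z : ℝ)|) + r * max 0 (1 - |(z : ℝ) + 1|) := by
  obtain ⟨h0, h1⟩ := hr
  rcases lt_trichotomy z 0 with h | rfl | h
  · rcases eq_or_lt_of_le (Int.add_one_le_iff.2 h) with h2 | h2
    · obtain rfl : z = -1 := by omega
      push_cast
      rw [abs_of_nonpos (by linarith : (-1 : ℝ) + r ≤ 0)]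
      norm_num [h0]
    · have h3 : (z : ℝ) ≤ -2 := by exact_mod_cast (by omega : z ≤ -2)
      rw [abs_of_nonpos (by linarith), abs_of_nonpos (by linarith), abs_of_nonpos (by linarith),
        max_eq_left (by linarith), max_eq_left (by linarith), max_eq_left (by linarith)]
      ring
  · rw [Int.cast_zero, zero_add, abs_of_nonneg h0, max_eq_right (by linarith)]
    norm_num
  · have h3 : (1 : ℝ) ≤ z := by exact_mod_cast h
    rw [abs_of_nonneg (by linarith), abs_of_nonneg (by linarith), abs_of_nonneg (by linarith),
      max_eq_left (by linarith), max_eq_left (by linarith), max_eq_left (by linarith)]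
    ring

theorem hat_mem_PL {n j : ℕ} (hj : 0 < j) (hjn : j < n) (u : E d) : hat n j u ∈ PL d n := by
  intro i hi r hr
  have hi' : (i : ℝ) + 1 ≤ n := by exact_mod_cast hi
  have hi0 : (0 : ℝ) ≤ i := by positivity
  have e (x : ℝ) : 2 * Real.pi * x / n = x * width n := by unfold width; ring
  rw [e, e, e, hat_apply hj hjn u (by linarith [hr.1]) (by linarith [hr.2]),
    hat_apply hj hjn u (by linarith) (by linarith),
    hat_apply hj hjn u (by linarith) (by linarith)]
  have := max_zero_one_sub_abs_add (i - j) hr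
  push_cast at this
  rw [show (i : ℝ) + r - j = i - j + r by ring, this,
    show (i : ℝ) + 1 - j = i - j + 1 by ring, smul_smul, smul_smul, ← add_smul]
  congr 1
  ring

/-- The hat function with its mean subtracted. Its only nonzero slopes are `u` and `-u`, on the two
cells adjacent to the `j`-th node. -/
def tent (n j : ℕ) (u : E d) : W d :=
  hat n j u + (-1 : ℝ) • constW ((2 * Real.pi)⁻¹ • integralL (hat n j u))

theorem tent_mem {n j : ℕ} (hj : 0 < j) (hjn : j < n) (u : E d) :
    tent n j u ∈ PL d n ∩ W0 d := by
  constructor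
  · refine PL_add_smul (hat_mem_PL hj hjn u) (constW_mem_PL n _) _
  · rw [mem_W0_iff, tent, map_add, map_smul]
    have h1 : integralL (constW ((2 * Real.pi)⁻¹ • integralL (hat n j u)))
        = integralL (hat n j u) := by
      change ∫ _ in (0 : ℝ)..(2 * Real.pi), ((2 * Real.pi)⁻¹ • integralL (hat n j u)) = _
      rw [intervalIntegral.integral_const, sub_zero, smul_inv_smul₀ Real.two_pi_pos.ne']
    rw [h1]; simp

theorem edge_tent {n j : ℕ} (hj : 0 < j) (hjn : j < n) (u : E d) {i : ℕ} (hi : i < n) :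
    edge n i (tent n j u) = if i + 1 = j then u else if i = j then -u else 0 := by
  have hw := (width_pos (hj.trans hjn)).ne'
  have h0 (v : E d) : edge n i (constW v) = 0 := by
    rw [edge_apply]
    change (width n)⁻¹ • (v - v) = 0
    rw [sub_self, smul_zero]
  have hi' : (i : ℝ) + 1 ≤ n := by exact_mod_cast hi
  rw [tent, map_add, map_smul, h0, smul_zero, add_zero, edge_apply, node, node,
    hat_apply hj hjn u (by positivity) (by push_cast; exact hi'),
    hat_apply hj hjn u (by positivity) (by linarith), ← sub_smul, smul_smul, ← mul_sub,
    inv_mul_cancel_left₀ hw]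
  split_ifs with h1 h2
  · subst h1; simp
  · subst h2; simp
  · have a1 : (1 : ℝ) ≤ |((i + 1 : ℕ) : ℝ) - j| := by
      have : (1 : ℤ) ≤ |((i + 1 : ℕ) : ℤ) - j| := Int.one_le_abs (by omega)
      exact_mod_cast this
    have a2 : (1 : ℝ) ≤ |(i : ℝ) - j| := by
      have : (1 : ℤ) ≤ |(i : ℤ) - j| := Int.one_le_abs (by omega)
      exact_mod_cast this
    rw [max_eq_left (by linarith), max_eq_left (by linarith)]; simp

/-! ### First variation of action integrals -/

/-- The first variation of an action integral: differentiation under the integral sign for a `C¹`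
integrand along a continuous curve. -/
theorem hasDerivAt_integral_add_smul {Z : Type*} [NormedAddCommGroup Z] [NormedSpace ℝ Z]
    [ProperSpace Z] {L : Z → ℝ} {U : Set Z} (hU : IsOpen U) (hL : ContDiffOn ℝ 1 L U)
    {a b : ℝ} (hab : a ≤ b) {γ η : ℝ → Z} (hγ : ContinuousOn γ (Icc a b))
    (hη : ContinuousOn η (Icc a b)) (hmem : ∀ t ∈ Icc a b, γ t ∈ U) :
    HasDerivAt (fun ε : ℝ => ∫ t in a..b, L (γ t + ε • η t))
      (∫ t in a..b, fderiv ℝ L (γ t) (η t)) 0 := by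
  -- Small variations stay in a compact neighbourhood `K ⊆ U` of the curve, where `fderiv ℝ L` is
  -- bounded; this gives the dominating constant.
  obtain ⟨δ, hδ, hK⟩ := (isCompact_Icc.image_of_continuousOn hγ).exists_cthickening_subset_open hU
    (image_subset_iff.2 hmem)
  set K := Metric.cthickening δ (γ '' Icc a b) with hKdef
  have hKc : IsCompact K := (isCompact_Icc.image_of_continuousOn hγ).cthickening
  have hfc : ContinuousOn (fderiv ℝ L) U := hL.continuousOn_fderiv_of_isOpen hU le_rfl
  obtain ⟨B, hB⟩ := hKc.exists_bound_of_continuousOn (hfc.mono hK)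
  obtain ⟨M, hM⟩ := isCompact_Icc.exists_bound_of_continuousOn hη
  have hM1 : 0 < |M| + 1 := by positivity
  have hin {ε : ℝ} (hε : ε ∈ Metric.ball (0 : ℝ) (δ / (|M| + 1))) {t : ℝ} (ht : t ∈ Icc a b) :
      γ t + ε • η t ∈ K := by
    refine Metric.mem_cthickening_of_dist_le _ (γ t) _ _ (mem_image_of_mem _ ht) ?_
    rw [dist_eq_norm, add_sub_cancel_left, norm_smul]
    rw [mem_ball_zero_iff] at hε
    have h1 : ‖η t‖ ≤ |M| + 1 := (hM t ht).trans (by linarith [le_abs_self M])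
    calc ‖ε‖ * ‖η t‖ ≤ δ / (|M| + 1) * (|M| + 1) := by gcongr
      _ = δ := by field_simp
  have hcont {ε : ℝ} (hε : ε ∈ Metric.ball (0 : ℝ) (δ / (|M| + 1))) :
      ContinuousOn (fun t => γ t + ε • η t) (Icc a b) := hγ.add (hη.const_smul ε)
  have hmeas {f : ℝ → ℝ} (hf : ContinuousOn f (Icc a b)) :
      AEStronglyMeasurable f (volume.restrict (uIoc a b)) := by
    rw [uIoc_of_le hab]
    exact (hf.mono Ioc_subset_Icc_self).aestronglyMeasurable measurableSet_Ioc
  have hball : Metric.ball (0 : ℝ) (δ / (|M| + 1)) ∈ nhds (0 : ℝ) :=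
    Metric.ball_mem_nhds _ (by positivity)
  have h0 : (0 : ℝ) ∈ Metric.ball (0 : ℝ) (δ / (|M| + 1)) := mem_of_mem_nhds hball
  have hFc {ε : ℝ} (hε : ε ∈ Metric.ball (0 : ℝ) (δ / (|M| + 1))) :
      ContinuousOn (fun t => L (γ t + ε • η t)) (Icc a b) :=
    hL.continuousOn.comp (hcont hε) fun t ht => hK (hin hε ht)
  have key := intervalIntegral.hasDerivAt_integral_of_dominated_loc_of_deriv_le (μ := volume)
    (a := a) (b := b) (F := fun ε t => L (γ t + ε • η t))
    (F' := fun ε t => fderiv ℝ L (γ t + ε • η t) (η t)) (x₀ := 0)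
    (bound := fun _ => B * (|M| + 1)) hball
    (Filter.mem_of_superset hball fun ε hε => hmeas (hFc hε))
    (ContinuousOn.intervalIntegrable (by rw [uIcc_of_le hab]; exact hFc h0))
    (hmeas ((hfc.comp (hcont h0) fun t ht => hK (hin h0 ht)).clm_apply hη))
    (Filter.Eventually.of_forall fun t ht ε hε => by
      rw [uIoc_of_le hab] at ht
      have ht' := Ioc_subset_Icc_self ht
      refine (ContinuousLinearMap.le_opNorm _ _).trans ?_
      have h1 := hB _ (hin hε ht')
      have h2 : ‖η t‖ ≤ |M| + 1 := (hM t ht').trans (by linarith [le_abs_self M])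
      exact mul_le_mul h1 h2 (norm_nonneg _) ((norm_nonneg _).trans h1))
    intervalIntegrable_const
    (Filter.Eventually.of_forall fun t ht ε hε => by
      rw [uIoc_of_le hab] at ht
      have h1 := ((hL.differentiableOn one_ne_zero).differentiableAt
        (hU.mem_nhds (hK (hin hε (Ioc_subset_Icc_self ht))))).hasFDerivAt
      have h2 : HasDerivAt (fun ε : ℝ => γ t + ε • η t) (η t) ε := by
        simpa using ((hasDerivAt_id ε).smul_const (η t)).const_add (γ t)
      exact h1.comp_hasDerivAt ε h2)
  simpa using key.2

/-- The du Bois-Reymond lemma on a compact interval. -/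
theorem derivWithin_eq_of_forall_integral_eq_zero {a b : ℝ} (hab : a < b) {f g : ℝ → ℝ}
    (hf : ContDiffOn ℝ 1 f (Icc a b)) (hg : ContinuousOn g (Icc a b))
    (H : ∀ φ : ℝ → ℝ, ContDiff ℝ ∞ φ → φ a = 0 → φ b = 0 →
      ∫ t in a..b, (deriv φ t * f t + φ t * g t) = 0) :
    EqOn (derivWithin f (Icc a b)) g (Icc a b) := by
  have hf' : ContinuousOn (derivWithin f (Icc a b)) (Icc a b) :=
    hf.continuousOn_derivWithin (uniqueDiffOn_Icc hab) le_rfl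
  have hzero : ∀ᵐ t, t ∈ Ioo a b → g t - derivWithin f (Icc a b) t = 0 := by
    refine isOpen_Ioo.ae_eq_zero_of_integral_contDiff_smul_eq_zero
      (((hg.sub hf').mono Ioo_subset_Icc_self).locallyIntegrableOn measurableSet_Ioo)
      fun φ hφ _ hsupp => ?_
    have hout (t : ℝ) (ht : t ∉ Ioo a b) : φ t = 0 :=
      image_eq_zero_of_notMem_tsupport fun h => ht (hsupp h)
    have hφa : φ a = 0 := hout a fun h => lt_irrefl _ h.1
    have hφb : φ b = 0 := hout b fun h => lt_irrefl _ h.2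
    have hφ' : Continuous (deriv φ) := hφ.continuous_deriv (by simp)
    have hii {u : ℝ → ℝ} (hu : ContinuousOn u (Icc a b)) : IntervalIntegrable u volume a b :=
      ContinuousOn.intervalIntegrable (by rwa [uIcc_of_le hab.le])
    have i1 : IntervalIntegrable (fun t => deriv φ t * f t) volume a b :=
      hii (hφ'.continuousOn.mul hf.continuousOn)
    have i2 : IntervalIntegrable (fun t => φ t * g t) volume a b :=
      hii (hφ.continuous.continuousOn.mul hg)
    have i3 : IntervalIntegrable (fun t => φ t * derivWithin f (Icc a b) t) volume a b :=
      hii (hφ.continuous.continuousOn.mul hf')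
    have hparts : ∫ t in a..b, (deriv φ t * f t + φ t * derivWithin f (Icc a b) t) = 0 := by
      rw [intervalIntegral.integral_eq_sub_of_hasDerivAt_of_le hab.le
        (f := fun t => φ t * f t) (hφ.continuous.continuousOn.mul hf.continuousOn)
        (fun t ht => ?_) (i1.add i3), hφa, hφb]
      · simp
      · have hft := ((hf.differentiableOn one_ne_zero t
          (Ioo_subset_Icc_self ht)).hasDerivWithinAt).hasDerivAt (Icc_mem_nhds ht.1 ht.2)
        exact ((hφ.differentiable (by simp)) t).hasDerivAt.mul hft
    have hH := H φ hφ hφa hφb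
    rw [intervalIntegral.integral_add i1 i3] at hparts
    rw [intervalIntegral.integral_add i1 i2] at hH
    have hφg : ∫ t in a..b, φ t * (g t - derivWithin f (Icc a b) t) = 0 := by
      simp only [mul_sub]
      rw [intervalIntegral.integral_sub i2 i3]
      linarith
    rw [← hφg, intervalIntegral.integral_of_le hab.le,
      setIntegral_eq_integral_of_forall_compl_eq_zero]
    · rfl
    · intro t ht
      rw [hout t fun h => ht (Ioo_subset_Ioc_self h), zero_mul]
  refine Measure.eqOn_Icc_of_ae_eq (μ := volume) hab.ne ?_ hf' hg
  rw [← restrict_Ioo_eq_restrict_Icc, Filter.EventuallyEq, ae_restrict_iff' measurableSet_Ioo]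
  filter_upwards [hzero] with t ht ht'
  linarith [ht ht']

/-! ### The Lagrangian on polygons -/

section Lagrangian

variable {ι F : Type*} [Fintype ι] [NormedAddCommGroup F]

/-- The Lagrangian of the metric in terms of the edges `x` of a polygon and their velocities `y`,
twice the kinetic energy `½ G_c(c_t, c_t)`. -/
def lagrangian (z : (ι → F) × (ι → F)) : ℝ :=
  (∑ i, ‖z.1 i‖)⁻¹ * ∑ i, ‖z.1 i‖⁻¹ * ‖z.2 i‖ ^ 2

variable (ι F) in
/-- The polygons without degenerate edges, with arbitrary velocity. -/
def nondegenerate : Set ((ι → F) × (ι → F)) := {z | ∀ i, z.1 i ≠ 0}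

theorem isOpen_nondegenerate : IsOpen (nondegenerate ι F) := by
  have : nondegenerate ι F = ⋂ i, {z | z.1 i ≠ 0} := by ext; simp [nondegenerate]
  rw [this]
  exact isOpen_iInter_of_finite fun i =>
    isOpen_ne.preimage ((continuous_apply i).comp continuous_fst)

theorem sum_norm_pos [Nonempty ι] {x : ι → F} (hx : ∀ i, x i ≠ 0) : 0 < ∑ i, ‖x i‖ :=
  Finset.sum_pos (fun i _ => norm_pos_iff.2 (hx i)) Finset.univ_nonempty

variable [InnerProductSpace ℝ F]

theorem contDiffOn_lagrangian [Nonempty ι] :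
    ContDiffOn ℝ 1 (lagrangian (ι := ι) (F := F)) (nondegenerate ι F) := by
  intro z hz
  refine ContDiffAt.contDiffWithinAt ?_
  have h1 (i : ι) : ContDiffAt ℝ 1 (fun z : (ι → F) × (ι → F) => z.1 i) z := by fun_prop
  have h2 (i : ι) : ContDiffAt ℝ 1 (fun z : (ι → F) × (ι → F) => z.2 i) z := by fun_prop
  have h3 (i : ι) := (h1 i).norm ℝ (hz i)
  refine ((ContDiffAt.sum fun i _ => h3 i).inv (sum_norm_pos hz).ne').mul
    (ContDiffAt.sum fun i _ => ((h3 i).inv (norm_ne_zero_iff.2 (hz i))).mul ((h2 i).norm_sq ℝ))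

theorem _root_.HasDerivWithinAt.norm_of_ne_zero {f : ℝ → F} {f' : F} {s : Set ℝ} {t : ℝ}
    (hf : HasDerivWithinAt f f' s t) (h0 : f t ≠ 0) :
    HasDerivWithinAt (fun t => ‖f t‖) (inner ℝ (f t) f' / ‖f t‖) s t := by
  have h1 := hf.norm_sq.sqrt (by simpa using h0)
  simp only [Real.sqrt_sq (norm_nonneg _)] at h1
  convert h1 using 1
  field_simp

/-- The partial derivative of half the Lagrangian in the `i`-th edge. -/
def force (x y : ι → F) (i : ι) : F :=
  -((2 * (∑ j, ‖x j‖) ^ 2 * ‖x i‖)⁻¹ * ∑ j, ‖x j‖⁻¹ * ‖y j‖ ^ 2) • x i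
    - (‖y i‖ ^ 2 / (2 * (∑ j, ‖x j‖) * ‖x i‖ ^ 3)) • x i

/-- The partial derivative of half the Lagrangian in the velocity of the `i`-th edge. -/
def impulse (x y : ι → F) (i : ι) : F := ((∑ j, ‖x j‖) * ‖x i‖)⁻¹ • y i

theorem fderiv_lagrangian [Nonempty ι] {x y : ι → F} (hx : ∀ i, x i ≠ 0) (k l : ι → F) :
    fderiv ℝ lagrangian (x, y) (k, l)
      = 2 * ∑ i, (inner ℝ (impulse x y i) (l i) + inner ℝ (force x y i) (k i)) := by
  have hd : HasDerivAt (fun ε : ℝ => lagrangian ((x, y) + ε • (k, l)))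
      (fderiv ℝ lagrangian (x, y) (k, l)) 0 := by
    have h1 := ((contDiffOn_lagrangian.differentiableOn one_ne_zero).differentiableAt
      (isOpen_nondegenerate.mem_nhds (show ((x, y) : (ι → F) × (ι → F)) ∈ _ from hx))).hasFDerivAt
    have h2 : HasDerivAt (fun ε : ℝ => (x, y) + ε • (k, l)) (k, l) 0 := by
      simpa using ((hasDerivAt_id (0 : ℝ)).smul_const (k, l)).const_add (x, y)
    have h3 : HasFDerivAt lagrangian (fderiv ℝ lagrangian (x, y)) ((x, y) + (0 : ℝ) • (k, l)) := by
      simpa using h1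
    exact h3.comp_hasDerivAt 0 h2
  have hline (p q : ι → F) (i : ι) :
      HasDerivWithinAt (fun ε : ℝ => p i + ε • q i) (q i) univ 0 := by
    refine HasDerivAt.hasDerivWithinAt ?_
    simpa using ((hasDerivAt_id (0 : ℝ)).smul_const (q i)).const_add (p i)
  have hn (i : ι) := (hline x k i).norm_of_ne_zero (by simpa using hx i)
  have hS := (HasDerivWithinAt.fun_sum fun i (_ : i ∈ Finset.univ) => hn i)
  have hN := HasDerivWithinAt.fun_sum fun i (_ : i ∈ Finset.univ) =>
    ((hn i).fun_inv (by simpa using hx i)).fun_mul (hline y l i).norm_sq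
  have htot := ((hS.fun_inv (by simpa using (sum_norm_pos hx).ne')).fun_mul hN).hasDerivAt
    Filter.univ_mem
  have heq := hd.unique htot
  rw [heq]
  simp only [zero_smul, add_zero, impulse, force, inner_sub_left, inner_smul_left,
    RCLike.conj_to_real]
  have hSne := (sum_norm_pos hx).ne'
  set S := ∑ i, ‖x i‖
  set N := ∑ i, ‖x i‖⁻¹ * ‖y i‖ ^ 2
  rw [neg_div, neg_mul, Finset.sum_div, Finset.sum_mul, Finset.mul_sum, Finset.mul_sum,
    ← Finset.sum_neg_distrib, ← Finset.sum_add_distrib]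
  refine Finset.sum_congr rfl fun i _ => ?_
  have hi : ‖x i‖ ≠ 0 := norm_ne_zero_iff.2 (hx i)
  field_simp
  ring

end Lagrangian

/-! ### The Euler–Lagrange equations of closed polygons -/

section EulerLagrange

variable {ι F : Type*} [Fintype ι] [NormedAddCommGroup F] [InnerProductSpace ℝ F]

/-- The time derivative of the impulse along a path with edges `x`, velocities `y` and
accelerations `z`. -/
def impulseDeriv (x y z : ι → F) (i : ι) : F :=
  ((∑ j, ‖x j‖) * ‖x i‖)⁻¹ • z i
    + (-((∑ j, inner ℝ (x j) (y j) / ‖x j‖) * ‖x i‖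
        + (∑ j, ‖x j‖) * (inner ℝ (x i) (y i) / ‖x i‖)) / ((∑ j, ‖x j‖) * ‖x i‖) ^ 2) • y i

theorem hasDerivWithinAt_impulse [Nonempty ι] {x y : ℝ → ι → F} {z : ι → F} {s : Set ℝ} {t : ℝ}
    (hx : ∀ i, HasDerivWithinAt (fun t => x t i) (y t i) s t)
    (hy : ∀ i, HasDerivWithinAt (fun t => y t i) (z i) s t) (h0 : ∀ i, x t i ≠ 0) (i : ι) :
    HasDerivWithinAt (fun t => impulse (x t) (y t) i) (impulseDeriv (x t) (y t) z i) s t := by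
  have hn (j : ι) := (hx j).norm_of_ne_zero (h0 j)
  have hS := HasDerivWithinAt.fun_sum fun j (_ : j ∈ Finset.univ) => hn j
  have hne : (∑ j, ‖x t j‖) * ‖x t i‖ ≠ 0 :=
    mul_ne_zero (sum_norm_pos h0).ne' (norm_ne_zero_iff.2 (h0 i))
  exact ((hS.fun_mul (hn i)).fun_inv hne).fun_smul (hy i)

theorem contDiffOn_impulse [Nonempty ι] {x y : ℝ → ι → F} {s : Set ℝ}
    (hx : ∀ i, ContDiffOn ℝ 1 (fun t => x t i) s) (hy : ∀ i, ContDiffOn ℝ 1 (fun t => y t i) s)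
    (h0 : ∀ t ∈ s, ∀ i, x t i ≠ 0) (i : ι) :
    ContDiffOn ℝ 1 (fun t => impulse (x t) (y t) i) s := by
  have hn (j : ι) : ContDiffOn ℝ 1 (fun t => ‖x t j‖) s := (hx j).norm ℝ fun t ht => h0 t ht j
  exact (((ContDiffOn.sum fun j _ => hn j).mul (hn i)).inv fun t ht =>
    mul_ne_zero (sum_norm_pos (h0 t ht)).ne' (norm_ne_zero_iff.2 (h0 t ht i))).smul (hy i)

theorem continuousOn_force [Nonempty ι] {x y : ℝ → ι → F} {s : Set ℝ}
    (hx : ∀ i, ContinuousOn (fun t => x t i) s) (hy : ∀ i, ContinuousOn (fun t => y t i) s)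
    (h0 : ∀ t ∈ s, ∀ i, x t i ≠ 0) (i : ι) :
    ContinuousOn (fun t => force (x t) (y t) i) s := by
  have hS : ContinuousOn (fun t => ∑ j, ‖x t j‖) s :=
    continuousOn_finsetSum _ fun j _ => (hx j).norm
  have hS0 (t : ℝ) (ht : t ∈ s) : ∑ j, ‖x t j‖ ≠ 0 := (sum_norm_pos (h0 t ht)).ne'
  have hn0 (j : ι) (t : ℝ) (ht : t ∈ s) : ‖x t j‖ ≠ 0 := norm_ne_zero_iff.2 (h0 t ht j)
  have hN : ContinuousOn (fun t => ∑ j, ‖x t j‖⁻¹ * ‖y t j‖ ^ 2) s :=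
    continuousOn_finsetSum _ fun j _ => ((hx j).norm.inv₀ (hn0 j)).mul ((hy j).norm.pow 2)
  refine ContinuousOn.sub (ContinuousOn.smul (ContinuousOn.neg (ContinuousOn.mul
    (ContinuousOn.inv₀ ((continuousOn_const.mul (hS.pow 2)).mul (hx i).norm) fun t ht => ?_) hN))
    (hx i)) (ContinuousOn.smul (ContinuousOn.div ((hy i).norm.pow 2)
      ((continuousOn_const.mul hS).mul ((hx i).norm.pow 3)) fun t ht => ?_) (hx i))
  · exact mul_ne_zero (mul_ne_zero two_ne_zero (pow_ne_zero _ (hS0 t ht))) (hn0 i t ht)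
  · exact mul_ne_zero (mul_ne_zero two_ne_zero (hS0 t ht)) (pow_ne_zero _ (hn0 i t ht))

/-- The value on the `i`-th edge of `⟨D_s c, D_s c_t⟩ D_s c_t - ½ |D_s c_t|² D_s c`. -/
def quadTerm (x y : ι → F) (i : ι) : F :=
  (inner ℝ (‖x i‖⁻¹ • x i) (‖x i‖⁻¹ • y i) : ℝ) • (‖x i‖⁻¹ • y i)
    - (1 / 2 * ‖‖x i‖⁻¹ • y i‖ ^ 2) • (‖x i‖⁻¹ • x i)

/-- Multiplied by `(∑ j, ‖x j‖) ‖x i‖`, the residual of the Euler–Lagrange equations takes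
the shape of the geodesic equation without the projection `π₀`. -/
theorem smul_impulseDeriv_sub_force [Nonempty ι] {x : ι → F} (hx : ∀ i, x i ≠ 0) (y z : ι → F)
    (i : ι) :
    ((∑ j, ‖x j‖) * ‖x i‖) • (impulseDeriv x y z i - force x y i)
      = z i - ((∑ j, ‖x j‖)⁻¹ * ∑ j, ‖x j‖⁻¹ * inner ℝ (x j) (y j)) • y i
        + (1 / 2 * ((∑ j, ‖x j‖)⁻¹ * ∑ j, ‖x j‖⁻¹ * inner ℝ (y j) (y j))) • x i
        - ‖x i‖ • quadTerm x y i := by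
  have hS := (sum_norm_pos hx).ne'
  have hi : ‖x i‖ ≠ 0 := norm_ne_zero_iff.2 (hx i)
  have e1 : ∑ j, inner ℝ (x j) (y j) / ‖x j‖ = ∑ j, ‖x j‖⁻¹ * inner ℝ (x j) (y j) :=
    Finset.sum_congr rfl fun j _ => by rw [div_eq_inv_mul]
  simp only [impulseDeriv, force, quadTerm, e1, inner_smul_left, inner_smul_right,
    RCLike.conj_to_real, norm_smul, norm_inv, norm_norm, real_inner_self_eq_norm_sq]
  set S := ∑ j, ‖x j‖
  set N := ∑ j, ‖x j‖⁻¹ * ‖y j‖ ^ 2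
  set A := ∑ j, ‖x j‖⁻¹ * inner ℝ (x j) (y j)
  match_scalars <;> field_simp <;> ring

/-- The Euler–Lagrange equations with a multiplier for the closing condition `∑ x_i = 0`, solved for
the accelerations: summing over the edges determines the multiplier. -/
theorem acceleration_eq_of_multiplier [Nonempty ι] {x y z : ι → F} (hx : ∀ i, x i ≠ 0)
    (hxs : ∑ i, x i = 0) (hys : ∑ i, y i = 0) (hzs : ∑ i, z i = 0) {q : F}
    (hq : ∀ i, impulseDeriv x y z i - force x y i = q) (i : ι) :
    z i = ((∑ j, ‖x j‖)⁻¹ * ∑ j, ‖x j‖⁻¹ * inner ℝ (x j) (y j)) • y i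
        - (1 / 2 * ((∑ j, ‖x j‖)⁻¹ * ∑ j, ‖x j‖⁻¹ * inner ℝ (y j) (y j))) • x i
        + ‖x i‖ • (quadTerm x y i - (∑ j, ‖x j‖)⁻¹ • ∑ j, ‖x j‖ • quadTerm x y j) := by
  have hS := (sum_norm_pos hx).ne'
  have key (j : ι) := smul_impulseDeriv_sub_force hx y z j
  simp only [hq] at key
  have hsum := Finset.sum_congr (rfl : (Finset.univ : Finset ι) = Finset.univ) fun j _ => key j
  rw [Finset.sum_sub_distrib, Finset.sum_add_distrib, Finset.sum_sub_distrib, ← Finset.smul_sum,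
    ← Finset.smul_sum, ← Finset.sum_smul, ← Finset.mul_sum, hxs, hys, hzs] at hsum
  simp only [smul_zero, sub_zero, add_zero, zero_sub] at hsum
  have hm : (∑ j, ‖x j‖) • q = -((∑ j, ‖x j‖)⁻¹ • ∑ j, ‖x j‖ • quadTerm x y j) := by
    rw [← smul_neg, ← hsum, smul_smul, inv_mul_cancel_left₀ hS]
  have hi := key i
  rw [mul_comm, mul_smul, hm] at hi
  rw [smul_sub, sub_eq_add_neg (‖x i‖ • quadTerm x y i), ← smul_neg, hi]
  abel

end EulerLagrange

/-! ### Paths of piecewise linear curves -/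

section Paths

variable {V X : Type*} [NormedAddCommGroup V] [NormedSpace ℝ V] [NormedAddCommGroup X]
  [NormedSpace ℝ X] {a b : ℝ} {c : ℝ → W d}

theorem hasDerivWithinAt_vel (hc : ContDiffOn ℝ 2 c (Icc a b)) {t : ℝ} (ht : t ∈ Icc a b) :
    HasDerivWithinAt c (vel a b c t) (Icc a b) t :=
  (hc.differentiableOn two_ne_zero t ht).hasDerivWithinAt

theorem contDiffOn_vel (hab : a < b) (hc : ContDiffOn ℝ 2 c (Icc a b)) :
    ContDiffOn ℝ 1 (vel a b c) (Icc a b) :=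
  hc.derivWithin (uniqueDiffOn_Icc hab) (by norm_num)

theorem hasDerivWithinAt_acc (hab : a < b) (hc : ContDiffOn ℝ 2 c (Icc a b)) {t : ℝ}
    (ht : t ∈ Icc a b) : HasDerivWithinAt (vel a b c) (acc a b c t) (Icc a b) t :=
  ((contDiffOn_vel hab hc).differentiableOn one_ne_zero t ht).hasDerivWithinAt

/-- A continuous linear constraint satisfied by a path is satisfied by its derivative. -/
theorem map_deriv_eq_zero (hab : a < b) {p : ℝ → V} {p' : V} {t : ℝ} (ht : t ∈ Icc a b)
    (hp : HasDerivWithinAt p p' (Icc a b) t) (T : V →L[ℝ] X) (hT : ∀ s ∈ Icc a b, T (p s) = 0) :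
    T p' = 0 :=
  (uniqueDiffOn_Icc hab t ht).eq_deriv _ (T.hasFDerivAt.comp_hasDerivWithinAt t hp)
    ((hasDerivWithinAt_const t (Icc a b) (0 : X)).congr hT (hT t ht))

theorem deriv_mem_PL_inter_W0 (hab : a < b) {n : ℕ} {p : ℝ → W d} {p' : W d} {t : ℝ}
    (ht : t ∈ Icc a b) (hp : HasDerivWithinAt p p' (Icc a b) t)
    (hmem : ∀ s ∈ Icc a b, p s ∈ PL d n ∩ W0 d) : p' ∈ PL d n ∩ W0 d := by
  refine ⟨?_, ?_⟩
  · rw [mem_PL_iff]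
    exact fun i hi r hr => map_deriv_eq_zero hab ht hp _ fun s hs =>
      mem_PL_iff.1 (hmem s hs).1 i hi r hr
  · rw [mem_W0_iff]
    exact map_deriv_eq_zero hab ht hp _ fun s hs => mem_W0_iff.1 (hmem s hs).2

end Paths

variable {n : ℕ} {a b : ℝ} {c : ℝ → W d}

/-- The slopes on all cells, i.e. the edges of a polygon up to the factor `width n`. -/
def edges (n : ℕ) : W d →L[ℝ] (Fin n → E d) := ContinuousLinearMap.pi fun i => edge n i

@[simp] theorem edges_apply (h : W d) (i : Fin n) : edges n h i = edge n i h := rfl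

theorem G_eq_edges (hn : 0 < n) {c h k : W d} (hc : c ∈ PL d n) (hh : h ∈ PL d n)
    (hk : k ∈ PL d n) :
    G c h k = (∑ i, ‖edges n c i‖)⁻¹ *
      ∑ i, ‖edges n c i‖⁻¹ * inner ℝ (edges n h i) (edges n k i) := by
  rw [G_eq hn hc hh hk, Finset.sum_range, Finset.sum_range]; rfl

theorem G_self_eq_lagrangian (hn : 0 < n) {c h : W d} (hc : c ∈ PL d n) (hh : h ∈ PL d n) :
    G c h h = lagrangian (edges n c, edges n h) := by
  rw [G_eq_edges hn hc hh hh]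
  simp only [lagrangian, real_inner_self_eq_norm_sq]

/-! ### The geodesic equation for the edges -/

namespace IsPLGeodesic

theorem mem_PL_inter_W0 (hc : IsPLGeodesic n a b c) : ∀ t ∈ Icc a b, c t ∈ PL d n ∩ W0 d :=
  fun t ht => ⟨(hc.mem t ht).1, (hc.mem t ht).2.2⟩

theorem vel_mem (hc : IsPLGeodesic n a b c) (hab : a < b) :
    ∀ t ∈ Icc a b, vel a b c t ∈ PL d n ∩ W0 d := fun _ ht =>
  deriv_mem_PL_inter_W0 hab ht (hasDerivWithinAt_vel hc.contDiffOn ht) hc.mem_PL_inter_W0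

theorem acc_mem (hc : IsPLGeodesic n a b c) (hab : a < b) :
    ∀ t ∈ Icc a b, acc a b c t ∈ PL d n ∩ W0 d := fun _ ht =>
  deriv_mem_PL_inter_W0 hab ht (hasDerivWithinAt_acc hab hc.contDiffOn ht) (hc.vel_mem hab)

theorem edges_ne_zero (hc : IsPLGeodesic n a b c) {t : ℝ} (ht : t ∈ Icc a b) (i : Fin n) :
    edges n (c t) i ≠ 0 :=
  PL.edge_ne_zero (Nat.zero_lt_of_lt i.2) (hc.mem t ht).1 (hc.mem t ht).2.1 i.2

/-- The first variation of the energy in the direction `φ(t) k`. -/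
theorem integral_first_variation (hc : IsPLGeodesic n a b c) (hn : 0 < n) (hab : a < b)
    {φ : ℝ → ℝ} (hφ : ContDiff ℝ ∞ φ) (hφa : φ a = 0) (hφb : φ b = 0) {k : W d}
    (hk : k ∈ PL d n ∩ W0 d) :
    ∫ t in a..b,
      (deriv φ t * ∑ i, inner ℝ (impulse (edges n (c t)) (edges n (vel a b c t)) i) (edges n k i)
      + φ t * ∑ i, inner ℝ (force (edges n (c t)) (edges n (vel a b c t)) i) (edges n k i))
      = 0 := by
  have : Nonempty (Fin n) := ⟨⟨0, hn⟩⟩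
  have hφd (t : ℝ) : HasDerivAt φ (deriv φ t) t := (hφ.differentiable (by simp) t).hasDerivAt
  have hφ' : Continuous (deriv φ) := hφ.continuous_deriv (by simp)
  have hvel := contDiffOn_vel hab hc.contDiffOn
  have hcrit := hc.critical (fun t => φ t • k) (hφ.smul contDiff_const)
    (fun t => by
      have h0 := zero_mem_PL_inter_W0 d n
      have h1 := And.intro (PL_add_smul h0.1 hk.1 (φ t)) (W0_add_smul h0.2 hk.2 (φ t))
      rwa [zero_add] at h1)
    (by simp [hφa]) (by simp [hφb])
  have hfirst := (hasDerivAt_integral_add_smul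
    (isOpen_nondegenerate (ι := Fin n) (F := E d)) contDiffOn_lagrangian hab.le
    (γ := fun t => (edges n (c t), edges n (vel a b c t)))
    (η := fun t => (φ t • edges n k, deriv φ t • edges n k))
    (((edges n).continuous.comp_continuousOn hc.contDiffOn.continuousOn).prodMk
      ((edges n).continuous.comp_continuousOn hvel.continuousOn))
    ((hφ.continuous.continuousOn.smul continuousOn_const).prodMk
      (hφ'.continuousOn.smul continuousOn_const))
    fun t ht i => hc.edges_ne_zero ht i).const_mul (1 / 2 : ℝ)
  have henergy (ε : ℝ) : energy a b (fun t => c t + ε • φ t • k)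
      = 1 / 2 * ∫ t in a..b, lagrangian ((edges n (c t), edges n (vel a b c t))
        + ε • (φ t • edges n k, deriv φ t • edges n k)) := by
    unfold energy
    congr 1
    refine intervalIntegral.integral_congr fun t ht => ?_
    rw [uIcc_of_le hab.le] at ht
    have hv : vel a b (fun t => c t + ε • φ t • k) t = vel a b c t + ε • deriv φ t • k :=
      ((hasDerivWithinAt_vel hc.contDiffOn ht).fun_add
        (((hφd t).smul_const k).const_smul ε).hasDerivWithinAt).derivWithin
        (uniqueDiffOn_Icc hab t ht)
    simp only [hv]
    rw [smul_smul, smul_smul, G_self_eq_lagrangian hn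
      (PL_add_smul (hc.mem t ht).1 hk.1 _) (PL_add_smul (hc.vel_mem hab t ht).1 hk.1 _)]
    simp only [map_add, map_smul, Prod.smul_mk, Prod.mk_add_mk, smul_smul]
  have h0 := hcrit.unique (hfirst.congr_of_eventuallyEq (Filter.Eventually.of_forall henergy))
  rw [← intervalIntegral.integral_const_mul] at h0
  rw [h0]
  refine intervalIntegral.integral_congr fun t ht => ?_
  rw [uIcc_of_le hab.le] at ht
  simp only [fderiv_lagrangian (hc.edges_ne_zero ht), Pi.smul_apply, inner_smul_right,
    Finset.sum_add_distrib, ← Finset.mul_sum]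
  ring

/-- The Euler–Lagrange equations of a geodesic in weak form, at each time and against each element
of the tangent space `P¹ ∩ W^{1,∞}_0`. -/
theorem sum_inner_eulerLagrange (hc : IsPLGeodesic n a b c) (hn : 0 < n) (hab : a < b)
    {k : W d} (hk : k ∈ PL d n ∩ W0 d) {t : ℝ} (ht : t ∈ Icc a b) :
    ∑ i, inner ℝ (impulseDeriv (edges n (c t)) (edges n (vel a b c t)) (edges n (acc a b c t)) i
      - force (edges n (c t)) (edges n (vel a b c t)) i) (edges n k i) = 0 := by
  have : Nonempty (Fin n) := ⟨⟨0, hn⟩⟩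
  have hvel := contDiffOn_vel hab hc.contDiffOn
  have hx (i : Fin n) : ContDiffOn ℝ 1 (fun t => edges n (c t) i) (Icc a b) :=
    (edge n i).contDiff.comp_contDiffOn (hc.contDiffOn.of_le (by norm_num))
  have hy (i : Fin n) : ContDiffOn ℝ 1 (fun t => edges n (vel a b c t) i) (Icc a b) :=
    (edge n i).contDiff.comp_contDiffOn hvel
  have h0 (t : ℝ) (ht : t ∈ Icc a b) (i : Fin n) := hc.edges_ne_zero ht i
  have hbr := derivWithin_eq_of_forall_integral_eq_zero hab
    (ContDiffOn.sum fun i (_ : i ∈ Finset.univ) =>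
      (contDiffOn_impulse hx hy h0 i).inner ℝ (contDiffOn_const (c := edges n k i)))
    (continuousOn_finsetSum _ fun i _ => (continuousOn_force (fun i => (hx i).continuousOn)
      (fun i => (hy i).continuousOn) h0 i).inner (continuousOn_const (c := edges n k i)))
    (fun φ hφ hφa hφb => hc.integral_first_variation hn hab hφ hφa hφb hk) ht
  have hder := HasDerivWithinAt.fun_sum fun i (_ : i ∈ Finset.univ) =>
    (hasDerivWithinAt_impulse
      (x := fun t => edges n (c t)) (y := fun t => edges n (vel a b c t))
      (z := edges n (acc a b c t)) (fun i =>
        (edge n i).hasFDerivAt.comp_hasDerivWithinAt t (hasDerivWithinAt_vel hc.contDiffOn ht))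
      (fun i =>
        (edge n i).hasFDerivAt.comp_hasDerivWithinAt t (hasDerivWithinAt_acc hab hc.contDiffOn ht))
      (h0 t ht) i).inner ℝ (hasDerivWithinAt_const t (Icc a b) (edges n k i))
  rw [hder.derivWithin (uniqueDiffOn_Icc hab t ht)] at hbr
  simp only [inner_zero_right, zero_add] at hbr
  simp only [inner_sub_left, Finset.sum_sub_distrib]
  exact sub_eq_zero.2 hbr

end IsPLGeodesic

theorem sum_inner_edges_tent {j : ℕ} (hj : 0 < j) (hjn : j < n) (X : Fin n → E d) (u : E d) :
    ∑ i, inner ℝ (X i) (edges n (tent n j u) i)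
      = inner ℝ (X ⟨j - 1, by omega⟩) u - inner ℝ (X ⟨j, hjn⟩) u := by
  have hterm (i : Fin n) : inner ℝ (X i) (edges n (tent n j u) i)
      = (if i = ⟨j - 1, by omega⟩ then inner ℝ (X i) u else 0)
        - (if i = ⟨j, hjn⟩ then inner ℝ (X i) u else 0) := by
    rw [edges_apply, edge_tent hj hjn u i.2]
    simp only [Fin.ext_iff]
    by_cases h1 : (i : ℕ) + 1 = j
    · rw [if_pos h1, if_pos (by omega), if_neg (by omega), sub_zero]
    · rw [if_neg h1, if_neg (by omega : ¬ (i : ℕ) = j - 1)]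
      split_ifs <;> simp
  simp only [hterm, Finset.sum_sub_distrib, Finset.sum_ite_eq', Finset.mem_univ, if_true]

/-- A covector on edges which annihilates all closed polygons is the same on every edge: the tents
at the interior nodes compare neighbouring edges. -/
theorem eq_of_forall_sum_inner_tent (hn : 0 < n) {X : Fin n → E d}
    (hX : ∀ k ∈ PL d n ∩ W0 d, ∑ i, inner ℝ (X i) (edges n k i) = 0) (i : Fin n) :
    X i = X ⟨0, hn⟩ := by
  obtain ⟨i, hi⟩ := i
  induction i with
  | zero => rfl
  | succ m ih =>
    rw [← ih (by omega)]
    refine ext_inner_right ℝ fun u => ?_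
    have h1 := hX _ (tent_mem m.succ_pos hi u)
    rw [sum_inner_edges_tent m.succ_pos hi] at h1
    exact (sub_eq_zero.1 h1).symm

theorem sum_edges (hn : 0 < n) (h : W d) : ∑ i, edges n h i = 0 := by
  rw [← sum_edge hn h, Finset.sum_range]; rfl

/-! ### The geodesic equation on the circle -/

/-- `D_s⁻¹ k` is the unique `f ∈ W^{1,∞}_0` with `D_s f = k`. -/
theorem DsInv_eq {c f : W d} {k : ℝ → E d} (hf : f ∈ W0 d)
    (hk : ∀ᵐ s : ℝ, f.der s = ‖c.der s‖ • k s) (θ : ℝ) : DsInv c k θ = f (θ : S1) := by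
  have hprim (ζ : ℝ) : ∫ η in (0 : ℝ)..ζ, ‖c.der η‖ • k η = f (ζ : S1) - f ((0 : ℝ) : S1) := by
    rw [← f.integral_der]
    refine intervalIntegral.integral_congr_ae ?_
    filter_upwards [hk] with s hs _ using hs.symm
  have hf0 : ∫ s in (0 : ℝ)..(2 * Real.pi), f (s : S1) = 0 := hf
  simp only [DsInv, hprim]
  rw [intervalIntegral.integral_sub (f.continuous_lift.intervalIntegrable _ _)
    intervalIntegrable_const, hf0, intervalIntegral.integral_const, zero_sub, sub_zero, smul_neg,
    inv_smul_smul₀ Real.two_pi_pos.ne']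
  abel

theorem IsPLGeodesic.solvesGeodesicEquation (hc : IsPLGeodesic n a b c) (hn : 0 < n)
    (hab : a < b) : SolvesGeodesicEquation a b c := by
  have : Nonempty (Fin n) := ⟨⟨0, hn⟩⟩
  refine ⟨hc.contDiffOn, fun t ht => (hc.mem t ht).2, fun t ht θ => ?_⟩
  have hcm := hc.mem_PL_inter_W0 t ht
  have hvm := hc.vel_mem hab t ht
  have ham := hc.acc_mem hab t ht
  have hx := hc.edges_ne_zero ht
  have hsol := acceleration_eq_of_multiplier hx (sum_edges hn (c t))
    (sum_edges hn (vel a b c t)) (sum_edges hn (acc a b c t)) (eq_of_forall_sum_inner_tent hn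
      fun k hk => hc.sum_inner_eulerLagrange hn hab hk ht)
  rw [← G_eq_edges hn hcm.1 hcm.1 hvm.1, ← G_eq_edges hn hcm.1 hvm.1 hvm.1] at hsol
  set A := G (c t) (c t) (vel a b c t)
  set B := G (c t) (vel a b c t) (vel a b c t)
  set k : ℝ → E d := fun s =>
    (inner ℝ (Ds (c t) (c t) s) (Ds (c t) (vel a b c t) s) : ℝ) • Ds (c t) (vel a b c t) s
      - (1 / 2 * ‖Ds (c t) (vel a b c t) s‖ ^ 2) • Ds (c t) (c t) s with hk
  set Q := quadTerm (edges n (c t)) (edges n (vel a b c t)) with hQ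
  have hmean : (len (c t))⁻¹ • ∫ η in (0 : ℝ)..(2 * Real.pi), ‖(c t).der η‖ • k η
      = (∑ j, ‖edges n (c t) j‖)⁻¹ • ∑ j, ‖edges n (c t) j‖ • Q j := by
    have hcell (i : ℕ) (hi : i < n) (s : ℝ)
        (hs : s ∈ Ioo (i * width n) ((i + 1 : ℕ) * width n)) :
        ‖(c t).der s‖ • k s = if h : i < n then ‖edges n (c t) ⟨i, h⟩‖ • Q ⟨i, h⟩ else 0 := by
      rw [dif_pos hi]
      simp only [hk, hQ, Ds, PL.der_cell hn hcm.1 hi hs, PL.der_cell hn hvm.1 hi hs, quadTerm,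
        edges_apply]
    rw [integral_eq_sum_cells hn hcell, len_eq hn hcm.1, Finset.sum_range, Finset.sum_range,
      smul_smul, mul_inv, mul_right_comm, inv_mul_cancel₀ (width_pos hn).ne', one_mul]
    simp
  -- The equation says that this combination of `c`, `c_t`, `c_tt` equals the `D_s⁻¹ π₀` term; it
  -- has mean zero, so comparing derivatives cell by cell suffices.
  set f : W d := acc a b c t + (-A) • vel a b c t + (1 / 2 * B) • c t with hf
  have hfPL : f ∈ PL d n := PL_add_smul (PL_add_smul ham.1 hvm.1 _) hcm.1 _
  have hfW0 : f ∈ W0 d := W0_add_smul (W0_add_smul ham.2 hvm.2 _) hcm.2 _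
  have hder : ∀ᵐ s : ℝ, f.der s = ‖(c t).der s‖ • proj0 (c t) k s := by
    filter_upwards [ae_exists_cell (d := d) hn] with s ⟨i, hi, hs⟩
    have hi' := hsol ⟨i, hi⟩
    rw [proj0, hmean]
    simp only [hk, Ds, hs _ hfPL, hs _ hcm.1, hs _ hvm.1]
    rw [hf, map_add, map_add, map_smul, map_smul]
    change edge n i (acc a b c t) = _ at hi'
    rw [hi']
    simp only [hQ, quadTerm, edges_apply]
    module
  rw [DsInv_eq hfW0 hder]
  simp only [hf, W.add_apply, W.smul_apply]
  module

end ElasticCurves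

theorem mainTheorem2 (d : ℕ) (hd : 2 ≤ d) (n : ℕ) (hn : 0 < n) (a b : ℝ) (hab : a < b)
    (c : ℝ → ElasticCurves.W d) (hc : ElasticCurves.IsPLGeodesic n a b c) :
    ElasticCurves.SolvesGeodesicEquation a b c ∧ ElasticCurves.IsSoliton n a b c :=
  ⟨hc.solvesGeodesicEquation hn hab, fun t ht => (hc.mem t ht).2, fun t ht =>
    ElasticCurves.momentum_eq_sum_delta hn (hc.mem t ht).1 (hc.vel_mem hab t ht).1⟩

end
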